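/- For a measurable set $S\subset[0,2\pi]$ let $|S|$ denote its normalized Lebesgue measure (so that $|[0,2\pi]|=1$), and let $PW_S$ be the space of all $f\in L^2(\mathbb R)$ whose Fourier transform $\hat f(t)=\int_{\mathbb R}e^{-ixt}f(x)\,\frac{dx}{2\pi}$ (understood in the $L^2$ sense) vanishes almost everywhere outside $S$, with the norm $\|f\|$ of $L^2(\mathbb R)$; each $f\in PW_S$ is identified with its continuous representative. A set $\Lambda\subset\mathbb Z$ is said to have uniform density $D(\Lambda)$ if $$D(\Lambda)=\lim_{r\to\infty}\frac{\min_{x\in\mathbb R}|\Lambda\cap[x,x+r]|}{r}=\lim_{r\to\infty}\frac{\max_{x\in\mathbb R}|\Lambda\cap[x,x+r]|}{r}.$$ Theorem 1. For every $d>0$ there is a constant $C(d)>0$, depending only on $d$, such that for every compact set $S\subset[0,2\pi]$ of positive measure there exists a set $\Lambda\subset\mathbb Z$, which is a finite union of arithmetic progressions $\{a+kq:k\in\mathbb Z\}$ ($a\in\mathbb Z$, $q\ge1$ an integer), which has a uniform density $D(\Lambda)<(1+d)|S|$, and for which $$C(d)\,|S|\,\|f\|^2\le\sum_{\lambda\in\Lambda}|f(\lambda)|^2<\infty\qquad\text{for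 all } f\in PW_S.$$ -/

import Mathlib

open MeasureTheory Filter Topology

noncomputable section

namespace PaleyWiener

/-- The normalized Lebesgue measure `|S|`, for which `[0, 2π]` has measure `1`. -/
def nmeas (S : Set ℝ) : ℝ := volume.real S / (2 * Real.pi)

/-- The Fourier transform `t ↦ ∫ e^{-ixt} f(x) dx / (2π)` of `f ∈ L²(ℝ)`. Mathlib's (Plancherel)
Fourier transform on `L²` extends `ξ ↦ ∫ e^{-2πixξ} f(x) dx`, hence the rescaling.
It is determined up to a null set, like every element of `L²`. -/
def fourierHat (F : Lp ℂ 2 (volume : Measure ℝ)) (t : ℝ) : ℂ :=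
  ((2 * Real.pi)⁻¹ : ℝ) *
    (FourierTransform.fourier F : Lp ℂ 2 (volume : Measure ℝ)) (t / (2 * Real.pi))

/-- The Paley-Wiener space `PW_S`: all `f ∈ L²(ℝ)` whose Fourier transform is supported by `S`,
i.e. vanishes almost everywhere outside `S`. The norm is that of `L²(ℝ)`. -/
def PW (S : Set ℝ) : Set (Lp ℂ 2 (volume : Measure ℝ)) :=
  {F | ∀ᵐ t : ℝ, t ∉ S → fourierHat F t = 0}

/-- The number `|Λ ∩ [x, x + r]|`. -/
def count (Λ : Set ℤ) (x r : ℝ) : ℕ := {n : ℤ | n ∈ Λ ∧ (n : ℝ) ∈ Set.Icc x (x + r)}.ncard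

/-- `D⁻(Λ) = D`, that is, `D` is the limit of `min_x |Λ ∩ [x, x + r]| / r` as `r → ∞`. -/
def HasLowerDensity (Λ : Set ℤ) (D : ℝ) : Prop :=
  Tendsto (fun r : ℝ => ((⨅ x : ℝ, count Λ x r : ℕ) : ℝ) / r) atTop (𝓝 D)

/-- `D⁺(Λ) = D`, that is, `D` is the limit of `max_x |Λ ∩ [x, x + r]| / r` as `r → ∞`. -/
def HasUpperDensity (Λ : Set ℤ) (D : ℝ) : Prop :=
  Tendsto (fun r : ℝ => ((⨆ x : ℝ, count Λ x r : ℕ) : ℝ) / r) atTop (𝓝 D)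

/-- `Λ` has uniform density `D(Λ) = D`. -/
def HasUniformDensity (Λ : Set ℤ) (D : ℝ) : Prop :=
  HasLowerDensity Λ D ∧ HasUpperDensity Λ D

/-- `Λ` is a finite union of (two-sided) arithmetic progressions `{a + k q : k ∈ ℤ}`, `q ≥ 1`. -/
def IsFiniteUnionAP (Λ : Set ℤ) : Prop :=
  ∃ T : Finset (ℤ × ℕ), (∀ p ∈ T, 1 ≤ p.2) ∧
    Λ = ⋃ p ∈ T, {n : ℤ | ∃ k : ℤ, n = p.1 + k * (p.2 : ℤ)}

/-- The sampling inequality `B ‖f‖² ≤ ∑_{λ ∈ Λ} |f(λ)|²` for all `f ∈ PW_S`. The values `f(λ)` are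
those of the continuous representative of `f` (it is unique; that it exists is part of the claim),
and the sum is a convergent one. -/
def SamplingBound (S : Set ℝ) (Λ : Set ℤ) (B : ℝ) : Prop :=
  ∀ F ∈ PW S, ∃ f : ℝ → ℂ, Continuous f ∧ F =ᵐ[volume] f ∧
    Summable (fun l : Λ => ‖f ((l : ℤ) : ℝ)‖ ^ 2) ∧
    B * ‖F‖ ^ 2 ≤ ∑' l : Λ, ‖f ((l : ℤ) : ℝ)‖ ^ 2

end PaleyWiener

end

/-!
Rescaled to `[0, 1]`, the spectrum `S` is covered by `n` of the `m` intervals `[l / m, (l + 1) / m]`,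
where by compactness `n / m` can be brought as close to `|S|` as desired (`exists_cover`). Let `I` be
the set of these `n` indices `l`. For `f ∈ PW_S` with Fourier transform `G`, the samples of `f` on the
residue class `j + m ℤ` are multiples of the Fourier coefficients, on `[0, 1 / m]`, of the function
`s ↦ ∑ l, e^{2πi j l / m} G (s + l / m)` times `e^{2πi j s}` (`hasSum_sq_fourierInv`).
By Parseval, sampling on `Λ = J + m ℤ` is therefore bounded below as soon as the rows `J` of the `m × m` Fourier matrix, restricted to the columns `I`, are bounded below
(`samplingBound_periodicSet`), and `Λ` has density `|J| / m` (`hasUniformDensity_periodicSet`).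

The theorem is thus reduced to finite dimension: the `m` normalized rows form a tight frame of unit
vectors in `ℂⁿ`, and one needs at most `(1 + d) n` of them whose frame bound is bounded below in terms
of `d` only. This is `exists_subframe`, proved with the lower barrier of Batson, Spielman and
Srivastava. Rows are added one at a time to `A = ∑ rᵢ uᵢ uᵢ^*`, all with weight one, while a barrier `l`
below the spectrum moves upwards by a fixed multiple of `1 / n` and the potential `tr (A - l)⁻¹` does
not increase. No upper barrier is used. Its purpose would be to control repetitions, and these are
bounded directly: in the averaging argument (`exists_row`) the rows that have already been taken `r₀`
times are left out, and they carry only a small part of `∑ uᵢ^* (A - l)⁻² uᵢ`, since by Chebyshev's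
inequality `tr ((A - l)⁻² A) ≤ (tr A / n) tr (A - l)⁻²`. As multiplicities are at most `r₀`, a
constant depending on `d`, dropping them costs only a constant factor.
-/

/-! ### Scalar inequalities for the barrier method -/

namespace PaleyWiener

open Finset in
/-- With `D` the change of the potential `∑ 1 / (x a + δ)` when the barrier moves up by `δ`, this is
the estimate `∑ 1 / (x a)² ≥ D (1 / δ + D)`, which makes a barrier step possible on average. -/
theorem barrier_cauchySchwarz {ν : Type*} [Fintype ν] (x : ν → ℝ) (hx : ∀ a, 0 < x a) {δ : ℝ}
    (hδ : 0 < δ) (h : δ * ∑ a, (x a + δ)⁻¹ ≤ 1) :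
    (∑ a, (x a)⁻¹ - ∑ a, (x a + δ)⁻¹) * (δ⁻¹ + (∑ a, (x a)⁻¹ - ∑ a, (x a + δ)⁻¹)) ≤
      ∑ a, ((x a)⁻¹) ^ 2 := by
  have hxδ : ∀ a, 0 < x a + δ := fun a => add_pos (hx a) hδ
  have hD : ∑ a, (x a)⁻¹ - ∑ a, (x a + δ)⁻¹ = δ * ∑ a, (x a)⁻¹ * (x a + δ)⁻¹ := by
    rw [← sum_sub_distrib, mul_sum]
    refine sum_congr rfl fun a _ => ?_
    have := (hx a).ne'; have := (hxδ a).ne'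
    field_simp; ring
  have hcs : (∑ a, (x a)⁻¹ * (x a + δ)⁻¹) ^ 2 ≤
      (∑ a, ((x a)⁻¹) ^ 2 * (x a + δ)⁻¹) * ∑ a, (x a + δ)⁻¹ := by
    refine sum_sq_le_sum_mul_sum_of_sq_le_mul _ (fun a _ => ?_) (fun a _ => ?_) fun a _ => ?_
    · have := hxδ a; positivity
    · exact (inv_pos.2 (hxδ a)).le
    · exact le_of_eq (by ring)
  have hdiff : ∑ a, ((x a)⁻¹) ^ 2 - ∑ a, (x a)⁻¹ * (x a + δ)⁻¹ =
      δ * ∑ a, ((x a)⁻¹) ^ 2 * (x a + δ)⁻¹ := by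
    rw [← sum_sub_distrib, mul_sum]
    refine sum_congr rfl fun a _ => ?_
    have := (hx a).ne'; have := (hxδ a).ne'
    field_simp; ring
  have hnn : 0 ≤ ∑ a, ((x a)⁻¹) ^ 2 * (x a + δ)⁻¹ :=
    sum_nonneg fun a _ => by have := hxδ a; positivity
  rw [hD]
  set V := ∑ a, (x a)⁻¹ * (x a + δ)⁻¹
  set W := ∑ a, ((x a)⁻¹) ^ 2 * (x a + δ)⁻¹
  set Y := ∑ a, (x a + δ)⁻¹
  have e : δ * V * (δ⁻¹ + δ * V) = V + δ ^ 2 * V ^ 2 := by field_simp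
  rw [e]
  have h1 : δ ^ 2 * V ^ 2 ≤ δ ^ 2 * (W * Y) := by gcongr
  have h2 : δ * W * (δ * Y) ≤ δ * W * 1 := by gcongr
  nlinarith

open Finset in
/-- Chebyshev's sum inequality: `y` and `1 / (y - c)²` are oppositely ordered. -/
theorem chebyshev_inv_sq {ν : Type*} [Fintype ν] (y : ν → ℝ) (c : ℝ) (hy : ∀ a, c < y a) :
    Fintype.card ν * ∑ a, y a * ((y a - c)⁻¹) ^ 2 ≤ (∑ a, y a) * ∑ a, ((y a - c)⁻¹) ^ 2 := by
  have h : Antivary y fun a => ((y a - c)⁻¹) ^ 2 := by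
    intro a b hab
    by_contra! hlt
    have h1 : 0 < y a - c := sub_pos.2 (hy a)
    have h2 : (y b - c)⁻¹ ≤ (y a - c)⁻¹ := by gcongr
    have h3 : 0 < (y b - c)⁻¹ := inv_pos.2 (sub_pos.2 (hy b))
    have : ((y b - c)⁻¹) ^ 2 ≤ ((y a - c)⁻¹) ^ 2 := by gcongr
    exact absurd hab (not_lt.2 this)
  exact h.card_mul_sum_le_sum_mul_sum

/-! ### Traces of resolvents -/

open Matrix
open scoped ComplexOrder

variable {ν : Type*} [Fintype ν] [DecidableEq ν]

/-- `shift A c` is the matrix `A - c` with real `c`, and `(shift A c)⁻¹` the resolvent of `A`. -/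
def shift (A : Matrix ν ν ℂ) (c : ℝ) : Matrix ν ν ℂ := A - (c : ℂ) • 1

/-- `g(A)` for a Hermitian matrix `A`, through its spectral decomposition. -/
noncomputable def hermFun {A : Matrix ν ν ℂ} (hA : A.IsHermitian) (g : ℝ → ℝ) : Matrix ν ν ℂ :=
  (hA.eigenvectorUnitary : Matrix ν ν ℂ) * diagonal (fun a => ((g (hA.eigenvalues a) : ℝ) : ℂ)) *
    (star hA.eigenvectorUnitary : Matrix ν ν ℂ)

variable {A : Matrix ν ν ℂ} (hA : A.IsHermitian)

theorem hermFun_mul (g h : ℝ → ℝ) :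
    hermFun hA g * hermFun hA h = hermFun hA fun x => g x * h x := by
  have : (star hA.eigenvectorUnitary : Matrix ν ν ℂ) * (hA.eigenvectorUnitary : Matrix ν ν ℂ) = 1 :=
    Unitary.coe_star_mul_self _
  unfold hermFun
  calc _ = (hA.eigenvectorUnitary : Matrix ν ν ℂ) *
        diagonal (fun a => ((g (hA.eigenvalues a) : ℝ) : ℂ)) *
        ((star hA.eigenvectorUnitary : Matrix ν ν ℂ) * (hA.eigenvectorUnitary : Matrix ν ν ℂ)) *
        diagonal (fun a => ((h (hA.eigenvalues a) : ℝ) : ℂ)) *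
        (star hA.eigenvectorUnitary : Matrix ν ν ℂ) := by simp only [Matrix.mul_assoc]
    _ = _ := by
      rw [this, Matrix.mul_one, Matrix.mul_assoc _ (diagonal _) (diagonal _), diagonal_mul_diagonal]
      simp

theorem hermFun_one : hermFun hA (fun _ => 1) = 1 := by
  unfold hermFun; simp

theorem hermFun_id : hermFun hA (fun x => x) = A := by
  conv_rhs => rw [hA.spectral_theorem]
  rfl

theorem hermFun_sub_const (c : ℝ) : hermFun hA (fun x => x - c) = shift A c := by
  have h : hermFun hA (fun x => x - c) =
      hermFun hA (fun x => x) - (c : ℂ) • hermFun hA fun _ => 1 := by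
    unfold hermFun
    rw [← Matrix.smul_mul, ← Matrix.mul_smul, ← Matrix.sub_mul, ← Matrix.mul_sub]
    congr 2
    ext i j
    by_cases hij : i = j <;> simp [hij, diagonal]
  rw [h, hermFun_id, hermFun_one, shift]

theorem trace_hermFun (g : ℝ → ℝ) :
    (hermFun hA g).trace = ((∑ a, g (hA.eigenvalues a) : ℝ) : ℂ) := by
  have : (star hA.eigenvectorUnitary : Matrix ν ν ℂ) * (hA.eigenvectorUnitary : Matrix ν ν ℂ) = 1 :=
    Unitary.coe_star_mul_self _
  unfold hermFun
  rw [Matrix.trace_mul_comm, ← Matrix.mul_assoc, this, Matrix.one_mul, trace_diagonal]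
  push_cast; rfl

theorem inv_shift_eq_hermFun {c : ℝ} (h : ∀ a, c < hA.eigenvalues a) :
    (shift A c)⁻¹ = hermFun hA fun x => (x - c)⁻¹ := by
  refine Matrix.inv_eq_right_inv ?_
  rw [← hermFun_sub_const hA, hermFun_mul, ← hermFun_one hA]
  unfold hermFun
  congr 3
  ext a
  exact congrArg _ (mul_inv_cancel₀ (sub_pos.2 (h a)).ne')

theorem posDef_shift_iff (c : ℝ) : (shift A c).PosDef ↔ ∀ a, c < hA.eigenvalues a := by
  constructor
  · intro h a
    have hv : A *ᵥ (hA.eigenvectorBasis a).ofLp =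
        (hA.eigenvalues a : ℂ) • (hA.eigenvectorBasis a).ofLp := by
      rw [hA.mulVec_eigenvectorBasis]; rfl
    have hne : (hA.eigenvectorBasis a).ofLp ≠ 0 := by
      intro h0
      exact hA.eigenvectorBasis.orthonormal.ne_zero a (by ext i; exact congrFun h0 i)
    have h1 := h.re_dotProduct_pos hne
    have h2 : (0 : ℝ) < (star (hA.eigenvectorBasis a).ofLp ⬝ᵥ (hA.eigenvectorBasis a).ofLp).re := by
      have := Matrix.PosDef.one (n := ν) (R := ℂ) |>.re_dotProduct_pos hne
      simpa using this
    unfold shift at h1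
    rw [sub_mulVec, hv, smul_mulVec, one_mulVec, ← sub_smul, dotProduct_smul, smul_eq_mul,
      ← Complex.ofReal_sub] at h1
    simp only [RCLike.re_to_complex, Complex.re_ofReal_mul] at h1
    exact sub_pos.1 (pos_of_mul_pos_left h1 h2.le)
  · intro h
    rw [← hermFun_sub_const hA]
    unfold hermFun
    have hd : (diagonal (fun a => ((hA.eigenvalues a - c : ℝ) : ℂ))).PosDef := by
      refine PosDef.diagonal fun a => ?_
      exact_mod_cast sub_pos.2 (h a)
    have hU : IsUnit (hA.eigenvectorUnitary : Matrix ν ν ℂ) :=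
      ⟨Unitary.toUnits hA.eigenvectorUnitary, rfl⟩
    exact (hU.posDef_star_right_conjugate_iff
      (x := diagonal (fun a => ((hA.eigenvalues a - c : ℝ) : ℂ)))).2 hd

/-- The Sherman–Morrison formula, for the trace of the resolvent. -/
theorem shift_add_rankOne (c : ℝ) (h : (shift A c).PosDef) (u : ν → ℂ) :
    (shift (A + vecMulVec u (star u)) c).PosDef ∧
    (shift (A + vecMulVec u (star u)) c)⁻¹.trace.re = (shift A c)⁻¹.trace.re -
      (star u ⬝ᵥ ((shift A c)⁻¹ * (shift A c)⁻¹) *ᵥ u).re /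
        (1 + (star u ⬝ᵥ (shift A c)⁻¹ *ᵥ u).re) := by
  have hs : shift (A + vecMulVec u (star u)) c = shift A c + vecMulVec u (star u) := by
    unfold shift; abel
  rw [hs]
  refine ⟨h.add_posSemidef (posSemidef_vecMulVec_self_star u), ?_⟩
  set P := shift A c
  have hu : IsUnit P.det := (Matrix.isUnit_iff_isUnit_det _).1 h.isUnit
  set R := P⁻¹ with hR
  have hPR : P * R = 1 := Matrix.mul_nonsing_inv _ hu
  set q := star u ⬝ᵥ R *ᵥ u with hq
  have hq0 : 0 ≤ q := h.inv.posSemidef.dotProduct_mulVec_nonneg u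
  have hqre : q = (q.re : ℂ) := by
    rw [Complex.le_def] at hq0
    exact Complex.ext rfl (by simpa using hq0.2.symm)
  have hq1 : (1 + q) ≠ 0 := by
    rw [hqre]
    rw [Complex.le_def] at hq0
    have : (0:ℝ) ≤ q.re := hq0.1
    have h1 : 1 + q.re ≠ 0 := by positivity
    exact_mod_cast h1
  have hinv : (P + vecMulVec u (star u))⁻¹ =
      R - (1 + q)⁻¹ • vecMulVec (R *ᵥ u) (star u ᵥ* R) := by
    refine Matrix.inv_eq_right_inv ?_
    have e1 : P * vecMulVec (R *ᵥ u) (star u ᵥ* R) = vecMulVec u (star u ᵥ* R) := by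
      rw [mul_vecMulVec, mulVec_mulVec, hPR, one_mulVec]
    have e2 : vecMulVec u (star u) * R = vecMulVec u (star u ᵥ* R) := by
      rw [vecMulVec_mul]
    have e3 : vecMulVec u (star u) * vecMulVec (R *ᵥ u) (star u ᵥ* R) =
        q • vecMulVec u (star u ᵥ* R) := by
      rw [vecMulVec_mul_vecMulVec, hq, vecMulVec_smul]
    rw [Matrix.mul_sub, Matrix.add_mul, Matrix.mul_smul, Matrix.add_mul, hPR, e1, e2, e3]
    have : (1 + q)⁻¹ • (vecMulVec u (star u ᵥ* R) + q • vecMulVec u (star u ᵥ* R)) =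
        vecMulVec u (star u ᵥ* R) := by
      rw [← one_smul ℂ (vecMulVec u (star u ᵥ* R)), smul_smul, ← add_smul, smul_smul]
      simp [inv_mul_cancel₀ hq1]
    rw [this]; abel
  rw [hinv, trace_sub, trace_smul, trace_vecMulVec]
  have e4 : (R *ᵥ u) ⬝ᵥ (star u ᵥ* R) = star u ⬝ᵥ (R * R) *ᵥ u := by
    rw [dotProduct_comm, ← dotProduct_mulVec, mulVec_mulVec]
  rw [e4, Complex.sub_re, hqre, smul_eq_mul]
  have : ((1 + (q.re : ℂ))⁻¹ : ℂ) = (((1 + q.re)⁻¹ : ℝ) : ℂ) := by push_cast; rfl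
  rw [this, Complex.re_ofReal_mul]
  simp only [Complex.ofReal_re]
  ring

end PaleyWiener

namespace PaleyWiener

open Matrix
open scoped ComplexOrder

/-! ### Selecting rows -/

/-- The frame operator `∑ᵢ rᵢ uᵢ uᵢ^*` of the vectors `uᵢ`, taken with multiplicities `rᵢ`. -/
def frameMatrix {ι ν : Type*} [Fintype ι] (u : ι → ν → ℂ) (r : ι → ℕ) : Matrix ν ν ℂ :=
  ∑ i, r i • vecMulVec (u i) (star (u i))

theorem frameMatrix_isHermitian {ι ν : Type*} [Fintype ι] (u : ι → ν → ℂ) (r : ι → ℕ) :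
    (frameMatrix u r).IsHermitian := by
  unfold frameMatrix IsHermitian
  rw [conjTranspose_sum]
  refine Finset.sum_congr rfl fun i _ => ?_
  rw [conjTranspose_nsmul, conjTranspose_vecMulVec, star_star]

theorem trace_mul_frameMatrix {ι ν : Type*} [Fintype ι] [Fintype ν] (u : ι → ν → ℂ) (r : ι → ℕ)
    (M : Matrix ν ν ℂ) :
    (M * frameMatrix u r).trace = ∑ i, (r i : ℂ) * (star (u i) ⬝ᵥ M *ᵥ u i) := by
  unfold frameMatrix
  rw [Matrix.mul_sum, trace_sum]
  refine Finset.sum_congr rfl fun i _ => ?_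
  rw [mul_smul_comm, trace_smul, mul_vecMulVec, trace_vecMulVec, dotProduct_comm, nsmul_eq_mul]

theorem frameMatrix_add_single {ι ν : Type*} [Fintype ι] [DecidableEq ι] (u : ι → ν → ℂ)
    (r : ι → ℕ) (i : ι) :
    frameMatrix u (r + Pi.single i 1) = frameMatrix u r + vecMulVec (u i) (star (u i)) := by
  unfold frameMatrix
  simp_rw [Pi.add_apply, add_smul]
  rw [Finset.sum_add_distrib]
  congr 1
  rw [Finset.sum_eq_single i]
  · simp
  · intro b _ hb; simp [hb]
  · simp

section

variable {ι ν : Type*} [Fintype ι] [DecidableEq ι] [Fintype ν] [DecidableEq ν]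

/-- One step of the selection, by averaging over the rows: a row that has been used fewer than `r₀`
times can be added such that the potential for the barrier `l + δ` is at most the former potential
for `l`. The saturated rows account for at most the fraction `η` of `κ tr (A - l - δ)⁻²`. -/
theorem exists_row [Nonempty ι] (u : ι → ν → ℂ) {κ : ℝ} (hκ : 1 ≤ κ)
    (hcard : κ * Fintype.card ν = Fintype.card ι)
    (hu : frameMatrix u (fun _ => 1) = (κ : ℂ) • 1)
    (r : ι → ℕ) {r₀ : ℕ} (hr₀ : 0 < r₀) {η δ l : ℝ} (hδ : 0 < δ) (hη : η < 1)
    (htr : (frameMatrix u r).trace.re ≤ η * r₀ * Fintype.card ν)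
    (hP : (shift (frameMatrix u r) l).PosDef)
    (hP' : (shift (frameMatrix u r) (l + δ)).PosDef)
    (hΦδ : δ * (shift (frameMatrix u r) l)⁻¹.trace.re ≤ 1)
    (hmain : (Fintype.card ν : ℝ) + η * (shift (frameMatrix u r) (l + δ))⁻¹.trace.re ≤
      (1 - η) * (δ⁻¹ - (shift (frameMatrix u r) l)⁻¹.trace.re)) :
    ∃ i, r i < r₀ ∧
      (shift (frameMatrix u (r + Pi.single i 1)) (l + δ)).PosDef ∧
      (shift (frameMatrix u (r + Pi.single i 1)) (l + δ))⁻¹.trace.re ≤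
        (shift (frameMatrix u r) l)⁻¹.trace.re := by
  set A := frameMatrix u r with hAdef
  have hA : A.IsHermitian := frameMatrix_isHermitian u r
  have hN : (0 : ℝ) < Fintype.card ν := by
    have h1 : (0 : ℝ) < Fintype.card ι := by exact_mod_cast Fintype.card_pos
    rw [← hcard] at h1
    exact pos_of_mul_pos_right h1 (by linarith)
  have hNe : Nonempty ν := Fintype.card_pos_iff.1 (by exact_mod_cast hN)
  have hy0 := (posDef_shift_iff hA l).1 hP
  have hy := (posDef_shift_iff hA (l + δ)).1 hP'
  set y := hA.eigenvalues
  set R := (shift A (l + δ))⁻¹ with hR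
  have hRf : R = hermFun hA fun t => (t - (l + δ))⁻¹ := inv_shift_eq_hermFun hA hy
  have hRR : R * R = hermFun hA fun t => ((t - (l + δ))⁻¹) ^ 2 := by
    rw [hRf, hermFun_mul]; simp only [pow_two]
  have hRRA : R * R * A = hermFun hA fun t => t * ((t - (l + δ))⁻¹) ^ 2 := by
    calc R * R * A = hermFun hA (fun t => ((t - (l + δ))⁻¹) ^ 2) * hermFun hA (fun t => t) := by
          rw [hermFun_id, hRR]
      _ = _ := by rw [hermFun_mul]; simp only [mul_comm]
  have hT1 : R.trace.re = ∑ a, (y a - (l + δ))⁻¹ := by rw [hRf, trace_hermFun, Complex.ofReal_re]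
  have hT0 : (shift A l)⁻¹.trace.re = ∑ a, (y a - (l + δ) + δ)⁻¹ := by
    rw [inv_shift_eq_hermFun hA hy0, trace_hermFun, Complex.ofReal_re]
    refine Finset.sum_congr rfl fun a _ => ?_
    congr 1; ring
  have hT2 : (R * R).trace.re = ∑ a, ((y a - (l + δ))⁻¹) ^ 2 := by
    rw [hRR, trace_hermFun, Complex.ofReal_re]
  have hTA : (R * R * A).trace.re = ∑ a, y a * ((y a - (l + δ))⁻¹) ^ 2 := by
    rw [hRRA, trace_hermFun, Complex.ofReal_re]
  have hx : ∀ a, 0 < y a - (l + δ) := fun a => sub_pos.2 (hy a)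
  have hcs := barrier_cauchySchwarz (fun a => y a - (l + δ)) hx hδ (by rw [← hT0]; exact hΦδ)
  have hch := chebyshev_inv_sq y (l + δ) hy
  have hsumy : A.trace.re = ∑ a, y a := by
    conv_lhs => rw [← hermFun_id hA]
    rw [trace_hermFun, Complex.ofReal_re]
  have hD : 0 < R.trace.re - (shift A l)⁻¹.trace.re := by
    rw [hT1, hT0, ← Finset.sum_sub_distrib]
    refine Finset.sum_pos (fun a _ => ?_) Finset.univ_nonempty
    rw [sub_pos]
    exact inv_strictAnti₀ (hx a) (by linarith)
  have hT2nonneg : 0 ≤ (R * R).trace.re := by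
    rw [hT2]; positivity
  rw [← hT1, ← hT0, ← hT2] at hcs
  rw [← hTA, ← hT2, ← hsumy] at hch
  set T0 := (shift A l)⁻¹.trace.re
  set T1 := R.trace.re
  set T2 := (R * R).trace.re
  have hch' : (R * R * A).trace.re ≤ η * r₀ * T2 := by
    have h1 : A.trace.re * T2 ≤ η * r₀ * Fintype.card ν * T2 := by gcongr
    have h2 : (Fintype.card ν : ℝ) * (R * R * A).trace.re ≤
        (Fintype.card ν : ℝ) * (η * r₀ * T2) := by linarith
    exact le_of_mul_le_mul_left h2 hN
  -- the quadratic forms of `R` and `R²` at the rows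
  have hRH : Rᴴ = R := hP'.inv.isHermitian
  have hq0 : ∀ i, 0 ≤ (star (u i) ⬝ᵥ R *ᵥ u i).re := fun i =>
    hP'.inv.posSemidef.re_dotProduct_nonneg (u i)
  have hp0 : ∀ i, 0 ≤ (star (u i) ⬝ᵥ (R * R) *ᵥ u i).re := fun i => by
    have := (posSemidef_conjTranspose_mul_self R).re_dotProduct_nonneg (u i)
    rwa [hRH] at this
  have hsum : ∀ M : Matrix ν ν ℂ, ∑ i, (star (u i) ⬝ᵥ M *ᵥ u i).re = κ * M.trace.re := fun M => by
    have := trace_mul_frameMatrix u (fun _ => 1) M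
    rw [hu] at this
    have h2 := congrArg Complex.re this
    simp only [mul_smul_comm, Matrix.mul_one, trace_smul, smul_eq_mul, Complex.re_ofReal_mul,
      Nat.cast_one, one_mul, Complex.re_sum] at h2
    exact h2.symm
  have hsumr : ∑ i, (r i : ℝ) * (star (u i) ⬝ᵥ (R * R) *ᵥ u i).re = (R * R * A).trace.re := by
    rw [hAdef, trace_mul_frameMatrix u r (R * R), Complex.re_sum]
    refine Finset.sum_congr rfl fun i _ => ?_
    rw [← Complex.ofReal_natCast, Complex.re_ofReal_mul]
  obtain ⟨i, hi, hpi⟩ : ∃ i, r i < r₀ ∧ (T1 - T0) * (1 + (star (u i) ⬝ᵥ R *ᵥ u i).re) ≤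
      (star (u i) ⬝ᵥ (R * R) *ᵥ u i).re := by
    by_contra! hcon
    have hr₀' : (0 : ℝ) < r₀ := by exact_mod_cast hr₀
    -- The last summand is at least the left side for the saturated rows. Hence the inequality holds
    -- for all rows and can be summed over the whole tight frame.
    have hlt : ∀ i, (star (u i) ⬝ᵥ (R * R) *ᵥ u i).re <
        (T1 - T0) * (1 + (star (u i) ⬝ᵥ R *ᵥ u i).re) +
          (r₀ : ℝ)⁻¹ * ((r i : ℝ) * (star (u i) ⬝ᵥ (R * R) *ᵥ u i).re) := by
      intro i
      have h0 := hp0 i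
      have h1 := hq0 i
      rcases lt_or_ge (r i) r₀ with h | h
      · have := hcon i h
        have : (0 : ℝ) ≤ (r₀ : ℝ)⁻¹ * ((r i : ℝ) * (star (u i) ⬝ᵥ (R * R) *ᵥ u i).re) := by
          positivity
        linarith
      · have h2 : (1 : ℝ) ≤ (r₀ : ℝ)⁻¹ * r i := by
          rw [inv_mul_eq_div, le_div_iff₀ hr₀', one_mul]; exact_mod_cast h
        have h3 : 0 < (T1 - T0) * (1 + (star (u i) ⬝ᵥ R *ᵥ u i).re) := by positivity
        nlinarith
    have hS := Finset.sum_lt_sum_of_nonempty (s := Finset.univ) Finset.univ_nonempty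
      (fun i _ => hlt i)
    rw [Finset.sum_add_distrib, ← Finset.mul_sum, ← Finset.mul_sum, Finset.sum_add_distrib, hsum,
      hsum, hsumr, Finset.sum_const, Finset.card_univ, nsmul_eq_mul, mul_one, ← hcard] at hS
    have h4 : (r₀ : ℝ)⁻¹ * (R * R * A).trace.re ≤ η * T2 := by
      rw [inv_mul_le_iff₀ hr₀']; linarith
    have h4' : 0 ≤ η * T2 := by
      refine le_trans ?_ h4
      rw [← hsumr]
      exact mul_nonneg (by positivity) (Finset.sum_nonneg fun i _ => by have := hp0 i; positivity)
    have h5 : η * T2 ≤ κ * (η * T2) := le_mul_of_one_le_left h4' hκ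
    have h6 : (Fintype.card ν : ℝ) + T1 ≤ (1 - η) * (δ⁻¹ + (T1 - T0)) := by linarith
    have h7 : (T1 - T0) * (Fintype.card ν + T1) ≤
        (T1 - T0) * ((1 - η) * (δ⁻¹ + (T1 - T0))) := by gcongr
    have h8 : (1 - η) * ((T1 - T0) * (δ⁻¹ + (T1 - T0))) ≤ (1 - η) * T2 :=
      mul_le_mul_of_nonneg_left hcs (by linarith)
    have h9 : κ * ((T1 - T0) * (Fintype.card ν + T1)) ≤ κ * ((1 - η) * T2) := by
      refine mul_le_mul_of_nonneg_left ?_ (by linarith)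
      linarith
    linarith
  obtain ⟨h1, h2⟩ := shift_add_rankOne (l + δ) hP' (u i)
  refine ⟨i, hi, ?_, ?_⟩
  · rw [frameMatrix_add_single]; exact h1
  · rw [frameMatrix_add_single, h2]
    have hq := hq0 i
    have : T1 - T0 ≤ (star (u i) ⬝ᵥ (R * R) *ᵥ u i).re / (1 + (star (u i) ⬝ᵥ R *ᵥ u i).re) := by
      rw [le_div_iff₀ (by positivity)]; exact hpi
    change T1 - _ ≤ T0
    linarith

/-- A bound for the potential keeps the barrier away from the spectrum, so that it can be moved up by
a small `δ`; the potential then grows by at most a constant factor. -/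
theorem posDef_shift_add {A : Matrix ν ν ℂ} (hA : A.IsHermitian) {l δ B : ℝ} (hδ : 0 < δ)
    (hP : (shift A l).PosDef) (hB : (shift A l)⁻¹.trace.re ≤ B) (hδB : δ * B < 1) :
    (shift A (l + δ)).PosDef ∧
      (shift A (l + δ))⁻¹.trace.re ≤ (1 - δ * B)⁻¹ * (shift A l)⁻¹.trace.re := by
  have hy0 := (posDef_shift_iff hA l).1 hP
  have hT0 : (shift A l)⁻¹.trace.re = ∑ a, (hA.eigenvalues a - l)⁻¹ := by
    rw [inv_shift_eq_hermFun hA hy0, trace_hermFun, Complex.ofReal_re]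
  have hx : ∀ a, 0 < hA.eigenvalues a - l := fun a => sub_pos.2 (hy0 a)
  have hle : ∀ a, (hA.eigenvalues a - l)⁻¹ ≤ B := fun a => by
    refine le_trans ?_ hB
    rw [hT0]
    exact Finset.single_le_sum (f := fun a => (hA.eigenvalues a - l)⁻¹)
      (fun b _ => (inv_pos.2 (hx b)).le) (Finset.mem_univ a)
  have hge : ∀ a, 1 ≤ B * (hA.eigenvalues a - l) := fun a => by
    have := mul_le_mul_of_nonneg_right (hle a) (hx a).le
    rwa [inv_mul_cancel₀ (hx a).ne'] at this
  have hkey : ∀ a, (1 - δ * B) * (hA.eigenvalues a - l) ≤ hA.eigenvalues a - (l + δ) := fun a => by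
    nlinarith [hge a]
  have hy : ∀ a, l + δ < hA.eigenvalues a := fun a => by
    have : 0 < (1 - δ * B) * (hA.eigenvalues a - l) := mul_pos (by linarith) (hx a)
    linarith [hkey a]
  refine ⟨(posDef_shift_iff hA _).2 hy, ?_⟩
  rw [inv_shift_eq_hermFun hA hy, trace_hermFun, Complex.ofReal_re, hT0, Finset.mul_sum]
  refine Finset.sum_le_sum fun a _ => ?_
  rw [← mul_inv]
  exact inv_anti₀ (mul_pos (by linarith) (hx a)) (hkey a)

/-- The state after `k` steps of the selection, with the barrier started at `-L`, where the potential
of the zero matrix is `n / L`, and moved up by `1 / (n (2 + 1 / L))` in each step. -/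
theorem exists_multiplicities [Nonempty ι] (u : ι → ν → ℂ) {κ : ℝ} (hκ : 1 ≤ κ)
    (hcard : κ * Fintype.card ν = Fintype.card ι)
    (hu : frameMatrix u (fun _ => 1) = (κ : ℂ) • 1) (hunit : ∀ i, star (u i) ⬝ᵥ u i = 1)
    {r₀ : ℕ} (hr₀ : 0 < r₀) {η L : ℝ} (hL : 0 < L) (hη₀ : 0 ≤ η)
    (hη : η * (L⁻¹ * (1 + (2 * L)⁻¹) + 2) ≤ 1) (k : ℕ) (hk : k ≤ η * r₀ * Fintype.card ν) :
    ∃ r : ι → ℕ, (∀ i, r i ≤ r₀) ∧ ∑ i, r i = k ∧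
      (shift (frameMatrix u r) (-L + k * (Fintype.card ν * (2 + L⁻¹))⁻¹)).PosDef ∧
      (shift (frameMatrix u r) (-L + k * (Fintype.card ν * (2 + L⁻¹))⁻¹))⁻¹.trace.re ≤
        Fintype.card ν / L := by
  have hN : (0 : ℝ) < Fintype.card ν := by
    have h1 : (0 : ℝ) < Fintype.card ι := by exact_mod_cast Fintype.card_pos
    rw [← hcard] at h1
    exact pos_of_mul_pos_right h1 (by linarith)
  induction k with
  | zero =>
    have h0 : frameMatrix u (0 : ι → ℕ) = 0 := by simp [frameMatrix]
    have h1 : shift (0 : Matrix ν ν ℂ) (-L) = (L : ℂ) • 1 := by simp [shift]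
    refine ⟨0, by simp, by simp, ?_, ?_⟩
    · rw [h0, Nat.cast_zero, zero_mul, add_zero, h1]
      exact PosDef.one.smul (by exact_mod_cast hL)
    · have h2 : ((L : ℂ) • (1 : Matrix ν ν ℂ))⁻¹ = ((L⁻¹ : ℝ) : ℂ) • 1 := by
        refine Matrix.inv_eq_right_inv ?_
        rw [smul_mul_smul_comm, ← Complex.ofReal_mul, mul_inv_cancel₀ hL.ne']
        simp
      rw [h0, Nat.cast_zero, zero_mul, add_zero, h1, h2, trace_smul, trace_one, smul_eq_mul,
        Complex.re_ofReal_mul, Complex.natCast_re, inv_mul_eq_div]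
  | succ k ih =>
    have hk' : (k : ℝ) ≤ η * r₀ * Fintype.card ν := by push_cast at hk; linarith
    obtain ⟨r, hr, hsum, hP, hΦ⟩ := ih hk'
    set δ : ℝ := (Fintype.card ν * (2 + L⁻¹))⁻¹ with hδdef
    set l : ℝ := -L + k * δ
    have hδ : 0 < δ := by positivity
    have hl : -L + ((k + 1 : ℕ) : ℝ) * δ = l + δ := by push_cast; ring
    rw [hl]
    have hδB : δ * (Fintype.card ν / L) = (1 + 2 * L)⁻¹ := by
      rw [hδdef]; field_simp; ring
    have hδB1 : δ * (Fintype.card ν / L) < 1 := by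
      rw [hδB]; exact inv_lt_one_of_one_lt₀ (by linarith)
    obtain ⟨hP', hT1⟩ := posDef_shift_add (frameMatrix_isHermitian u r) hδ hP hΦ hδB1
    have hfac : (1 - δ * (Fintype.card ν / L))⁻¹ = 1 + (2 * L)⁻¹ := by
      rw [hδB]
      have : 1 - (1 + 2 * L)⁻¹ = 2 * L / (1 + 2 * L) := by field_simp; ring
      rw [this]; field_simp; ring
    rw [hfac] at hT1
    have hT1' : (shift (frameMatrix u r) (l + δ))⁻¹.trace.re ≤
        Fintype.card ν * (L⁻¹ * (1 + (2 * L)⁻¹)) := by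
      calc _ ≤ (1 + (2 * L)⁻¹) * (Fintype.card ν / L) := hT1.trans (by gcongr)
        _ = _ := by ring
    have htr : (frameMatrix u r).trace.re = k := by
      have := trace_mul_frameMatrix u r 1
      simp only [Matrix.one_mul, one_mulVec, hunit, mul_one] at this
      rw [this, ← hsum]; simp
    have hE : 0 < L⁻¹ * (1 + (2 * L)⁻¹) := by positivity
    have hη1 : η < 1 := by nlinarith
    have hδinv : δ⁻¹ = Fintype.card ν * (2 + L⁻¹) := inv_inv _
    obtain ⟨i, hi, h1, h2⟩ := exists_row u hκ hcard hu r hr₀ hδ hη1 (by rw [htr]; exact hk') hP hP'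
      (le_trans (mul_le_mul_of_nonneg_left hΦ hδ.le) hδB1.le) (by
        have e1 : η * (shift (frameMatrix u r) (l + δ))⁻¹.trace.re ≤
          η * (Fintype.card ν * (L⁻¹ * (1 + (2 * L)⁻¹))) := by gcongr
        have e2 : (1 - η) * (Fintype.card ν * 2) ≤
            (1 - η) * (δ⁻¹ - (shift (frameMatrix u r) l)⁻¹.trace.re) := by
          refine mul_le_mul_of_nonneg_left ?_ (by linarith)
          rw [hδinv]
          have : (Fintype.card ν : ℝ) / L = Fintype.card ν * L⁻¹ := rfl
          linarith
        have e3 := mul_le_mul_of_nonneg_left hη hN.le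
        linarith)
    refine ⟨r + Pi.single i 1, fun j => ?_, ?_, h1, h2.trans hΦ⟩
    · by_cases hj : j = i
      · subst hj; simpa using hi
      · simpa [hj] using hr j
    · simp [Finset.sum_add_distrib, hsum]

end

/-- Restricted invertibility with a lower bound depending only on `d`: from a tight frame of unit
vectors in dimension `n` one can select at most `(1 + d) n` vectors that still form a frame whose
lower bound is at least a constant. -/
theorem exists_subframe {d : ℝ} (hd : 0 < d) : ∃ c : ℝ, 0 < c ∧
    ∀ (ι ν : Type) [Fintype ι] [DecidableEq ι] [Nonempty ι] [Fintype ν] [DecidableEq ν]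
      (u : ι → ν → ℂ) (κ : ℝ), 1 ≤ κ → κ * Fintype.card ν = Fintype.card ι →
      frameMatrix u (fun _ => 1) = (κ : ℂ) • 1 → (∀ i, star (u i) ⬝ᵥ u i = 1) →
      2 ≤ d * Fintype.card ν →
      ∃ J : Finset ι, (J.card : ℝ) ≤ (1 + d) * Fintype.card ν ∧
        ∀ w : ν → ℂ, c * ∑ a, ‖w a‖ ^ 2 ≤ ∑ i ∈ J, ‖star (u i) ⬝ᵥ w‖ ^ 2 := by
  -- After `k ≥ (1 + d / 2) n` steps the barrier has moved from `-L` by at least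
  -- `(1 + d / 2) / (2 + 1 / L)`; `L = d / 8` makes its final position positive.
  set L : ℝ := d / 8 with hLdef
  have hL : 0 < L := by positivity
  set E : ℝ := L⁻¹ * (1 + (2 * L)⁻¹) + 2
  have hE0 : 0 < E := by positivity
  obtain ⟨r₀, hr₀⟩ := exists_nat_gt ((1 + d) * E)
  have hr₀' : (0 : ℝ) < r₀ := lt_trans (by positivity) hr₀
  set η : ℝ := (1 + d) / r₀ with hη
  refine ⟨(d / 4 / (2 + L⁻¹)) / r₀, by positivity, ?_⟩
  intro ι ν _ _ _ _ _ u κ hκ hcard hu hunit hdN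
  have hN : (0 : ℝ) < Fintype.card ν := by
    have h1 : (0 : ℝ) < d * Fintype.card ν := by linarith
    exact pos_of_mul_pos_right h1 hd.le
  have hηr : η * r₀ = 1 + d := by rw [hη]; field_simp
  have hηE : η * E ≤ 1 := by
    rw [hη, div_mul_eq_mul_div, div_le_one hr₀']; exact hr₀.le
  -- `2 ≤ d n` pays for the rounding
  set k := ⌊(1 + d) * Fintype.card ν⌋₊ with hkdef
  have hk : (k : ℝ) ≤ (1 + d) * Fintype.card ν := Nat.floor_le (by positivity)
  have hk2 : (1 + d / 2) * Fintype.card ν ≤ k := by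
    have := Nat.lt_floor_add_one ((1 + d) * (Fintype.card ν : ℝ))
    rw [← hkdef] at this
    linarith
  obtain ⟨r, hr, hsum, hP, -⟩ := exists_multiplicities u hκ hcard hu hunit
    (by exact_mod_cast hr₀') hL (by positivity) hηE k (by rw [hηr]; exact hk)
  set l : ℝ := -L + k * (Fintype.card ν * (2 + L⁻¹))⁻¹
  have hlge : d / 4 / (2 + L⁻¹) ≤ l := by
    have h1 : (1 + d / 2) / (2 + L⁻¹) ≤ k * (Fintype.card ν * (2 + L⁻¹))⁻¹ := by
      rw [← div_eq_mul_inv, div_le_div_iff₀ (by positivity) (by positivity)]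
      have : 0 < 2 + L⁻¹ := by positivity
      nlinarith
    have h2 : (1 + d / 2) / (2 + L⁻¹) - L = d / 4 / (2 + L⁻¹) := by
      rw [hLdef]; field_simp; ring
    linarith
  refine ⟨Finset.univ.filter fun i => r i ≠ 0, ?_, fun w => ?_⟩
  · refine le_trans ?_ hk
    rw [← hsum]
    norm_cast
    rw [Finset.card_filter]
    refine Finset.sum_le_sum fun i _ => ?_
    split_ifs with h
    · exact Nat.zero_le _
    · exact Nat.one_le_iff_ne_zero.2 h
  · have hquad : (star w ⬝ᵥ frameMatrix u r *ᵥ w).re = ∑ i, (r i : ℝ) * ‖star (u i) ⬝ᵥ w‖ ^ 2 := by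
      unfold frameMatrix
      rw [sum_mulVec, dotProduct_sum, Complex.re_sum]
      refine Finset.sum_congr rfl fun i _ => ?_
      rw [smul_mulVec, vecMulVec_mulVec, dotProduct_smul, op_smul_eq_smul, dotProduct_smul]
      have : star w ⬝ᵥ u i = star (star (u i) ⬝ᵥ w) := by
        rw [← star_dotProduct_star, star_star]
      rw [this, smul_eq_mul, nsmul_eq_mul, ← Complex.ofReal_natCast, Complex.re_ofReal_mul,
        Complex.star_def, Complex.mul_conj, Complex.ofReal_re, Complex.normSq_eq_norm_sq]
    have hww : (star w ⬝ᵥ w).re = ∑ a, ‖w a‖ ^ 2 := by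
      rw [dotProduct, Complex.re_sum]
      refine Finset.sum_congr rfl fun a _ => ?_
      rw [Pi.star_apply, Complex.star_def, mul_comm, Complex.mul_conj, Complex.ofReal_re,
        Complex.normSq_eq_norm_sq]
    have h1 : l * ∑ a, ‖w a‖ ^ 2 ≤ ∑ i, (r i : ℝ) * ‖star (u i) ⬝ᵥ w‖ ^ 2 := by
      have := hP.posSemidef.re_dotProduct_nonneg w
      unfold shift at this
      rw [sub_mulVec, dotProduct_sub, smul_mulVec, one_mulVec, dotProduct_smul, smul_eq_mul] at this
      simp only [RCLike.re_to_complex, Complex.sub_re, Complex.re_ofReal_mul] at this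
      rw [hquad, hww] at this
      linarith
    have h2 : ∑ i, (r i : ℝ) * ‖star (u i) ⬝ᵥ w‖ ^ 2 ≤
        r₀ * ∑ i with r i ≠ 0, ‖star (u i) ⬝ᵥ w‖ ^ 2 := by
      rw [Finset.sum_filter, Finset.mul_sum]
      refine Finset.sum_le_sum fun i _ => ?_
      split_ifs with h
      · have : (r i : ℝ) ≤ r₀ := by exact_mod_cast hr i
        gcongr
      · simp only [not_not] at h; simp [h]
    have h3 : d / 4 / (2 + L⁻¹) * ∑ a, ‖w a‖ ^ 2 ≤ l * ∑ a, ‖w a‖ ^ 2 := by gcongr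
    rw [div_mul_eq_mul_div, div_le_iff₀ hr₀', mul_comm _ (r₀ : ℝ)]
    linarith

end PaleyWiener

namespace PaleyWiener

/-! ### Periodic sets of integers -/

/-- The set of all integers that are congruent modulo `m` to an element of `J`. -/
def periodicSet {m : ℕ} (J : Finset (Fin m)) : Set ℤ :=
  ⋃ j ∈ J, {n : ℤ | ∃ k : ℤ, n = (j : ℕ) + k * (m : ℤ)}

theorem isFiniteUnionAP_periodicSet {m : ℕ} (hm : 0 < m) (J : Finset (Fin m)) :
    IsFiniteUnionAP (periodicSet J) := by
  refine ⟨J.image fun j : Fin m => ((((j : ℕ) : ℤ), m) : ℤ × ℕ), ?_, ?_⟩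
  · intro p hp
    obtain ⟨j, -, rfl⟩ := Finset.mem_image.1 hp
    exact hm
  · unfold periodicSet
    rw [Finset.set_biUnion_finset_image]

/-- The parametrization `(j, k) ↦ j + k m` of `J + m ℤ`, where `0 ≤ j < m`. -/
noncomputable def periodicSetEquiv {m : ℕ} (hm : 0 < m) (J : Finset (Fin m)) :
    (J × ℤ) ≃ periodicSet J :=
  Equiv.ofBijective
    (fun p => ⟨((p.1 : Fin m) : ℕ) + p.2 * (m : ℤ), by
      simp only [periodicSet, Set.mem_iUnion]
      exact ⟨p.1, p.1.2, p.2, rfl⟩⟩) (by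
    have hm' : (0 : ℤ) < m := by exact_mod_cast hm
    constructor
    · rintro ⟨j, k⟩ ⟨j', k'⟩ h
      simp only [Subtype.mk.injEq] at h
      have hj : (((j : Fin m) : ℕ) : ℤ) < m := by exact_mod_cast (j : Fin m).2
      have hj' : (((j' : Fin m) : ℕ) : ℤ) < m := by exact_mod_cast (j' : Fin m).2
      have h1 := congrArg (· % (m : ℤ)) h
      simp only [Int.add_mul_emod_self_right] at h1
      rw [Int.emod_eq_of_lt (by positivity) hj, Int.emod_eq_of_lt (by positivity) hj'] at h1
      have h2 : k = k' := by
        rw [h1] at h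
        exact mul_right_cancel₀ hm'.ne' (add_left_cancel h)
      have h3 : j = j' := Subtype.ext (Fin.ext (by exact_mod_cast h1))
      rw [h2, h3]
    · rintro ⟨n, hn⟩
      simp only [periodicSet, Set.mem_iUnion] at hn
      obtain ⟨j, hj, k, rfl⟩ := hn
      exact ⟨(⟨j, hj⟩, k), rfl⟩)

theorem abs_count_periodicSet_sub_le {m : ℕ} (hm : 0 < m) (J : Finset (Fin m)) (x : ℝ) {r : ℝ}
    (hr : 0 ≤ r) : |(count (periodicSet J) x r : ℝ) - J.card / m * r| ≤ J.card := by
  have hm' : (0 : ℝ) < m := by exact_mod_cast hm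
  set g : (_ : J) × ℤ → ℤ := fun p => (periodicSetEquiv hm J (p.1, p.2) : ℤ) with hg
  have hgv : ∀ p, g p = ((p.1 : Fin m) : ℕ) + p.2 * (m : ℤ) := fun p => rfl
  have hinj : Function.Injective g := by
    rintro ⟨j, k⟩ ⟨j', k'⟩ h
    have := (periodicSetEquiv hm J).injective (Subtype.ext h)
    rw [Prod.mk.injEq] at this
    exact Sigma.ext this.1 (heq_of_eq this.2)
  set f : J → Finset ℤ := fun j => Finset.Icc ⌈(x - ((j : Fin m) : ℕ)) / m⌉
    ⌊(x - ((j : Fin m) : ℕ)) / m + r / m⌋ with hf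
  have hset : {n : ℤ | n ∈ periodicSet J ∧ (n : ℝ) ∈ Set.Icc x (x + r)} =
      g '' ((Finset.univ.sigma f : Finset ((_ : J) × ℤ)) : Set ((_ : J) × ℤ)) := by
    have hmem : ∀ (j : J) (k : ℤ), k ∈ f j ↔
        (((((j : Fin m) : ℕ) + k * (m : ℤ) : ℤ) : ℝ) ∈ Set.Icc x (x + r)) := by
      intro j k
      rw [hf, Finset.mem_Icc, Int.ceil_le, Int.le_floor, Set.mem_Icc, ← add_div,
        div_le_iff₀ hm', le_div_iff₀ hm']
      push_cast
      constructor <;> rintro ⟨h1, h2⟩ <;> constructor <;> linarith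
    ext n
    simp only [Set.mem_ofPred_eq, Set.mem_image, Finset.mem_coe, Finset.mem_sigma, Finset.mem_univ,
      true_and]
    constructor
    · rintro ⟨hn, hx⟩
      obtain ⟨⟨j, k⟩, h⟩ := (periodicSetEquiv hm J).surjective ⟨n, hn⟩
      have h' : g ⟨j, k⟩ = n := congrArg Subtype.val h
      refine ⟨⟨j, k⟩, (hmem j k).2 ?_, h'⟩
      rw [← h', hgv] at hx
      exact hx
    · rintro ⟨⟨j, k⟩, hk, rfl⟩
      exact ⟨(periodicSetEquiv hm J (j, k)).2, (hmem j k).1 hk⟩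
  have hcount : (count (periodicSet J) x r : ℝ) = ∑ j : J, ((f j).card : ℝ) := by
    rw [count, hset, Set.ncard_image_of_injective _ hinj, Set.ncard_coe_finset, Finset.card_sigma,
      Nat.cast_sum]
  have hsum : (J.card / m * r : ℝ) = ∑ _j : J, r / m := by
    rw [Finset.sum_const, Finset.card_univ, Fintype.card_coe, nsmul_eq_mul]; ring
  rw [hcount, hsum, ← Finset.sum_sub_distrib]
  refine (Finset.abs_sum_le_sum_abs _ _).trans ?_
  have : (J.card : ℝ) = ∑ _j : J, (1 : ℝ) := by simp
  rw [this]
  refine Finset.sum_le_sum fun j _ => ?_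
  rw [hf, Int.card_Icc]
  set p := (x - ((j : Fin m) : ℕ)) / m
  have hrm : 0 ≤ r / m := by positivity
  have h1 := Int.ceil_lt_add_one p
  have h2 := Int.le_ceil p
  have h3 := Int.floor_le (p + r / m)
  have h4 := Int.lt_floor_add_one (p + r / m)
  have h0 : (((⌊p + r / m⌋ + 1 - ⌈p⌉).toNat : ℤ) : ℝ) =
      max ((⌊p + r / m⌋ : ℝ) + 1 - ⌈p⌉) 0 := by
    rw [Int.toNat_eq_max]; push_cast; rfl
  rw [Int.cast_natCast] at h0
  rw [h0, abs_le]
  constructor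
  · linarith [le_max_left ((⌊p + r / m⌋ : ℝ) + 1 - ⌈p⌉) 0]
  · rw [sub_le_iff_le_add]
    exact max_le (by linarith) (by linarith)

theorem hasUniformDensity_periodicSet {m : ℕ} (hm : 0 < m) (J : Finset (Fin m)) :
    HasUniformDensity (periodicSet J) (J.card / m) := by
  have hb := fun x r hr => abs_count_periodicSet_sub_le hm J x (r := r) hr
  have hlim : ∀ g : ℝ → ℕ, (∀ r, 0 ≤ r → |(g r : ℝ) - J.card / m * r| ≤ J.card) →
      Tendsto (fun r : ℝ => (g r : ℝ) / r) atTop (𝓝 (J.card / m)) := by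
    intro g hg
    rw [tendsto_iff_norm_sub_tendsto_zero]
    refine squeeze_zero' (g := fun r : ℝ => J.card / r) (.of_forall fun _ => norm_nonneg _) ?_
      (tendsto_const_nhds.div_atTop tendsto_id)
    filter_upwards [eventually_gt_atTop 0] with r hr
    have : (g r : ℝ) / r - J.card / m = ((g r : ℝ) - J.card / m * r) / r := by field_simp
    rw [this, norm_div, Real.norm_eq_abs, Real.norm_of_nonneg hr.le]
    gcongr
    exact hg r hr.le
  have hbdd : ∀ r, 0 ≤ r → BddAbove (Set.range fun x : ℝ => count (periodicSet J) x r) := by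
    intro r hr
    obtain ⟨M, hM⟩ := exists_nat_ge (J.card / m * r + J.card : ℝ)
    refine ⟨M, ?_⟩
    rintro _ ⟨x, rfl⟩
    have := (abs_le.1 (hb x r hr)).2
    exact_mod_cast (by linarith : (count (periodicSet J) x r : ℝ) ≤ M)
  refine ⟨hlim _ fun r hr => ?_, hlim _ fun r hr => ?_⟩
  · obtain ⟨x, hx⟩ := Nat.sInf_mem (Set.range_nonempty fun x : ℝ => count (periodicSet J) x r)
    rw [iInf, ← hx]
    exact hb x r hr
  · obtain ⟨x, hx⟩ := Nat.sSup_mem (Set.range_nonempty fun x : ℝ => count (periodicSet J) x r)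
      (hbdd r hr)
    rw [iSup, ← hx]
    exact hb x r hr

end PaleyWiener

namespace PaleyWiener

/-! ### Fourier analysis on Paley-Wiener spaces -/

open scoped FourierTransform SchwartzMap ContDiff

/-- If the `L²` Fourier transform of `F` is integrable, then `F` is almost everywhere the inverse
Fourier integral of it. -/
theorem ae_eq_fourierInv (F : Lp ℂ 2 (volume : Measure ℝ))
    (hG : Integrable (𝓕 F : Lp ℂ 2 (volume : Measure ℝ)) volume) :
    F =ᵐ[volume] 𝓕⁻ ((𝓕 F : Lp ℂ 2 (volume : Measure ℝ)) : ℝ → ℂ) := by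
  set G : ℝ → ℂ := ((𝓕 F : Lp ℂ 2 (volume : Measure ℝ)) : ℝ → ℂ)
  have hcont : Continuous (𝓕⁻ G) := by
    exact VectorFourier.fourierIntegral_continuous Real.continuous_fourierChar
      (by exact (continuous_fst.inner continuous_snd).neg) hG
  refine ae_eq_of_integral_contDiff_smul_eq ((Lp.memLp F).locallyIntegrable (by norm_num))
    hcont.locallyIntegrable fun g hg hgc => ?_
  have hgc' : HasCompactSupport fun x => (g x : ℂ) := hgc.comp_left (g := ((↑) : ℝ → ℂ)) rfl
  have hg' : ContDiff ℝ ∞ fun x => (g x : ℂ) := Complex.ofRealCLM.contDiff.comp hg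
  set h : 𝓢(ℝ, ℂ) := hgc'.toSchwartzMap hg'
  have hhv : ∀ x, h x = (g x : ℂ) := fun x => rfl
  have h1 : ∫ x, g x • F x = Lp.toTemperedDistribution F h := by
    rw [Lp.toTemperedDistribution_apply]
    simp only [hhv, smul_eq_mul, Complex.real_smul]
  have h2 : Lp.toTemperedDistribution F h = ∫ x, (𝓕⁻ h : 𝓢(ℝ, ℂ)) x • G x := by
    have : h = 𝓕 (𝓕⁻ h : 𝓢(ℝ, ℂ)) := (FourierTransform.fourier_fourierInv_eq h).symm
    conv_lhs => rw [this]
    rw [← TemperedDistribution.fourier_apply, Lp.fourier_toTemperedDistribution_eq,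
      Lp.toTemperedDistribution_apply]
  have h3 : ∫ x, (𝓕⁻ h : 𝓢(ℝ, ℂ)) x • G x = ∫ x, h x • (𝓕⁻ G) x := by
    rw [SchwartzMap.fourierInv_coe]
    have := VectorFourier.integral_fourierIntegral_smul_eq_flip (μ := volume) (ν := volume)
      (L := -innerₗ ℝ) Real.continuous_fourierChar
      (by exact (continuous_fst.inner continuous_snd).neg) h.integrable hG
    refine this.trans ?_
    congr 1
    ext x
    congr 2
    ext
    simp
  rw [h1, h2, h3]
  simp only [hhv, Complex.real_smul, smul_eq_mul]

theorem sum_intervalIntegral_fin {E : Type*} [NormedAddCommGroup E] [NormedSpace ℝ E] {m : ℕ}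
    (hm : 0 < m) {φ : ℝ → E} (hφ : Integrable φ) :
    ∫ ξ in (0 : ℝ)..1, φ ξ = ∑ l : Fin m, ∫ s in (0 : ℝ)..1 / m, φ (s + (l : ℕ) / m) := by
  have hm' : (m : ℝ) ≠ 0 := by positivity
  have h := intervalIntegral.sum_integral_adjacent_intervals (f := φ) (μ := volume)
    (a := fun k : ℕ => (k : ℝ) / m) (n := m) fun k _ => hφ.intervalIntegrable
  rw [Nat.cast_zero, zero_div, div_self hm'] at h
  rw [← h, Finset.sum_range]
  refine Finset.sum_congr rfl fun l _ => ?_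
  rw [intervalIntegral.integral_comp_add_right (fun s => φ s)]
  congr 1
  · rw [zero_add]
  · push_cast; ring

/-- The function `G` folded to `[0, 1 / m]`: the discrete Fourier transform, at the frequency `j`,
of the values of `G` on `s + (1 / m) ℤ ∩ [0, 1)`. -/
noncomputable def fold (m j : ℕ) (G : ℝ → ℂ) (s : ℝ) : ℂ :=
  ∑ l : Fin m, Complex.exp (2 * Real.pi * Complex.I * j * (l : ℕ) / m) * G (s + (l : ℕ) / m)

theorem memLp_fold (m j : ℕ) {G : ℝ → ℂ} (hG : MemLp G 2) : MemLp (fold m j G) 2 :=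
  memLp_finsetSum _ fun _ _ => MemLp.const_mul
    (hG.comp_measurePreserving (measurePreserving_add_right volume _)) _

/-- Parseval's identity on one residue class: sampling the inverse Fourier transform of `G` on
`j + m ℤ` amounts to folding `G` to an interval of length `1 / m`. -/
theorem hasSum_sq_fourierInv {m : ℕ} (hm : 0 < m) (j : ℕ) {G : ℝ → ℂ} (hG : MemLp G 2)
    (hGi : Integrable G) (h0 : ∀ᵐ ξ, ξ ∉ Set.Icc (0 : ℝ) 1 → G ξ = 0) :
    HasSum (fun k : ℤ => ‖𝓕⁻ G (((j + k * (m : ℤ) : ℤ)) : ℝ)‖ ^ 2)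
      ((m : ℝ)⁻¹ * ∫ s in (0 : ℝ)..1 / m,
        ‖fold m j G s‖ ^ 2) := by
  have hmR : (0 : ℝ) < m := by exact_mod_cast hm
  have hmC : (m : ℂ) ≠ 0 := by exact_mod_cast hm.ne'
  have hpos : (0 : ℝ) < 1 / m := by positivity
  set H : ℝ → ℂ := fun s => Complex.exp (2 * Real.pi * Complex.I * j * s) * fold m j G s with hH
  have hHnorm : ∀ s, ‖H s‖ = ‖fold m j G s‖ := by
    intro s
    have : 2 * (Real.pi : ℂ) * Complex.I * j * s = ((2 * Real.pi * j * s : ℝ) : ℂ) * Complex.I := by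
      push_cast; ring
    rw [hH]
    simp only [norm_mul]
    rw [this, Complex.norm_exp_ofReal_mul_I, one_mul]
  have hHm : MemLp H 2 volume := by
    have h1 := memLp_fold m j hG
    refine h1.of_le (AEStronglyMeasurable.mul ?_ h1.1) (.of_forall fun s => (hHnorm s).le)
    exact (by fun_prop : Continuous fun s : ℝ =>
      Complex.exp (2 * Real.pi * Complex.I * j * s)).aestronglyMeasurable
  have hcoef : ∀ k : ℤ, fourierCoeffOn hpos H (-k) = m * 𝓕⁻ G (((j + k * (m : ℤ) : ℤ)) : ℝ) := by
    intro k
    rw [fourierCoeffOn_eq_integral, neg_neg, sub_zero, one_div_one_div, Complex.real_smul,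
      Complex.ofReal_natCast]
    congr 1
    set e : ℝ → ℂ := fun ξ => Complex.exp (2 * Real.pi * Complex.I * (j + k * m) * ξ) with he
    have hnorm : ∀ ξ, ‖e ξ‖ = 1 := fun ξ => by
      have : 2 * (Real.pi : ℂ) * Complex.I * (j + k * m) * ξ =
          ((2 * Real.pi * (j + k * m) * ξ : ℝ) : ℂ) * Complex.I := by push_cast; ring
      rw [he]; simp only
      rw [this, Complex.norm_exp_ofReal_mul_I]
    have hei : Integrable fun ξ => e ξ * G ξ := by
      refine hGi.bdd_mul (c := 1) ?_ (.of_forall fun ξ => (hnorm ξ).le)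
      exact (by fun_prop : Continuous e).aestronglyMeasurable
    have hinv : 𝓕⁻ G (((j + k * (m : ℤ) : ℤ)) : ℝ) = ∫ ξ in (0 : ℝ)..1, e ξ * G ξ := by
      rw [Real.fourierInv_eq', intervalIntegral.integral_of_le zero_le_one,
        ← integral_Icc_eq_integral_Ioc, ← integral_indicator measurableSet_Icc]
      refine integral_congr_ae ?_
      filter_upwards [h0] with ξ hξ
      by_cases h : ξ ∈ Set.Icc (0 : ℝ) 1
      · rw [Set.indicator_of_mem h, smul_eq_mul, he]
        congr 2
        simp
        ring
      · rw [Set.indicator_of_notMem h, hξ h, smul_zero]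
    rw [hinv, sum_intervalIntegral_fin hm hei, ← intervalIntegral.integral_finsetSum
      fun l _ => (hei.comp_add_right _).intervalIntegrable]
    refine intervalIntegral.integral_congr fun s _ => ?_
    simp only [hH, smul_eq_mul, fold]
    rw [fourier_coe_apply, Finset.mul_sum, Finset.mul_sum]
    refine Finset.sum_congr rfl fun l _ => ?_
    -- the translation by `l / m` does not see the frequency `k m`
    have hper : Complex.exp (((k * (l : ℕ) : ℤ) : ℂ) * (2 * Real.pi * Complex.I)) = 1 :=
      Complex.exp_int_mul_two_pi_mul_I _
    rw [he]
    simp only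
    rw [← mul_assoc, ← mul_assoc, ← Complex.exp_add, ← Complex.exp_add, ← mul_one (Complex.exp _),
      ← hper, ← Complex.exp_add]
    congr 2
    push_cast
    field_simp
    ring
  have hP := hasSum_sq_fourierCoeffOn hpos (hHm.restrict _)
  rw [← (Equiv.neg ℤ).hasSum_iff] at hP
  have hP2 := hP.mul_left ((m : ℝ)⁻¹ ^ 2)
  have hfun : (fun k : ℤ => ‖𝓕⁻ G (((j + k * (m : ℤ) : ℤ)) : ℝ)‖ ^ 2) = fun k : ℤ =>
      (m : ℝ)⁻¹ ^ 2 * ((fun i => ‖fourierCoeffOn hpos H i‖ ^ 2) ∘ Equiv.neg ℤ) k := by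
    funext k
    rw [Function.comp_apply, Equiv.neg_apply, hcoef, norm_mul, mul_pow, ← mul_assoc,
      Complex.norm_natCast, ← mul_pow, inv_mul_cancel₀ hmR.ne', one_pow, one_mul]
  rw [hfun]
  have hval : (m : ℝ)⁻¹ * ∫ s in (0 : ℝ)..1 / m, ‖fold m j G s‖ ^ 2 =
      (m : ℝ)⁻¹ ^ 2 * (1 / (m : ℝ) - 0)⁻¹ • ∫ s in (0 : ℝ)..1 / m, ‖H s‖ ^ 2 := by
    simp only [hHnorm]
    rw [sub_zero, smul_eq_mul, ← mul_assoc]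
    congr 1
    field_simp
  rw [hval]
  exact hP2

end PaleyWiener

namespace PaleyWiener

open scoped FourierTransform

theorem fourier_eq_zero_of_mem_PW {S : Set ℝ} {F : Lp ℂ 2 (volume : Measure ℝ)} (hF : F ∈ PW S) :
    ∀ᵐ ξ : ℝ, 2 * Real.pi * ξ ∉ S → (𝓕 F : Lp ℂ 2 (volume : Measure ℝ)) ξ = 0 := by
  have hpi : (2 * Real.pi : ℝ) ≠ 0 := by positivity
  have hq : Measure.QuasiMeasurePreserving (fun ξ : ℝ => 2 * Real.pi * ξ) volume volume := by
    refine ⟨by fun_prop, ?_⟩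
    rw [Real.map_volume_mul_left hpi]
    exact Measure.smul_absolutelyContinuous
  filter_upwards [hq.ae hF] with ξ hξ hS
  have := hξ hS
  unfold fourierHat at this
  rw [mul_div_cancel_left₀ _ hpi, mul_eq_zero] at this
  refine this.resolve_left ?_
  exact_mod_cast inv_ne_zero hpi

theorem norm_sq_eq_integral (F : Lp ℂ 2 (volume : Measure ℝ)) : ‖F‖ ^ 2 = ∫ x, ‖F x‖ ^ 2 := by
  have h := congr_arg RCLike.re (L2.inner_def (𝕜 := ℂ) F F)
  rw [← integral_re (L2.integrable_inner F F)] at h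
  simp only [← norm_sq_eq_re_inner] at h
  exact h

/-- If the columns `I` of the `m × m` Fourier matrix cover `S` and the rows `J` are bounded below on
these columns, then `J + m ℤ` is a set of sampling for `PW_S`. -/
theorem samplingBound_periodicSet {m : ℕ} (hm : 0 < m) (J I : Finset (Fin m)) {c : ℝ}
    (hJ : ∀ g : Fin m → ℂ, (∀ l ∉ I, g l = 0) → c * ∑ l, ‖g l‖ ^ 2 ≤ ∑ j ∈ J, ‖∑ l : Fin m,
      Complex.exp (2 * Real.pi * Complex.I * (j : ℕ) * (l : ℕ) / m) * g l‖ ^ 2)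
    {S : Set ℝ} (hS : S ⊆ Set.Icc 0 (2 * Real.pi))
    (hI : ∀ l : Fin m, ∀ s ∈ Set.Ioc (0 : ℝ) (1 / m), 2 * Real.pi * (s + (l : ℕ) / m) ∈ S → l ∈ I) :
    SamplingBound S (periodicSet J) (c / m) := by
  intro F hF
  have hmR : (0 : ℝ) < m := by exact_mod_cast hm
  have hpos : (0 : ℝ) < 1 / m := by positivity
  have hpi : (0 : ℝ) < 2 * Real.pi := by positivity
  have hz := fourier_eq_zero_of_mem_PW hF
  have hFG : ‖F‖ ^ 2 = ∫ ξ, ‖(𝓕 F : Lp ℂ 2 (volume : Measure ℝ)) ξ‖ ^ 2 := by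
    rw [← norm_sq_eq_integral, Lp.norm_fourier_eq]
  have hinv := ae_eq_fourierInv F
  have hG : MemLp ((𝓕 F : Lp ℂ 2 (volume : Measure ℝ)) : ℝ → ℂ) 2 := Lp.memLp _
  set G : ℝ → ℂ := ((𝓕 F : Lp ℂ 2 (volume : Measure ℝ)) : ℝ → ℂ)
  have h0 : ∀ᵐ ξ, ξ ∉ Set.Icc (0 : ℝ) 1 → G ξ = 0 := by
    filter_upwards [hz] with ξ hξ hn
    refine hξ fun hmem => hn ?_
    have := hS hmem
    exact ⟨by nlinarith [this.1], by nlinarith [this.2]⟩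
  have hGi : Integrable G :=
    IntegrableOn.integrable_of_ae_notMem_eq_zero (s := Set.Icc 0 1)
      ((hG.restrict _).integrable (by norm_num)) h0
  have hcont : Continuous (𝓕⁻ G) :=
    VectorFourier.fourierIntegral_continuous Real.continuous_fourierChar
      (by exact (continuous_fst.inner continuous_snd).neg) hGi
  have hP := fun j : J => hasSum_sq_fourierInv hm (j : Fin m) hG hGi h0
  have hsumJ : Summable fun p : J × ℤ =>
      ‖𝓕⁻ G (((((p.1 : Fin m) : ℕ) + p.2 * (m : ℤ) : ℤ)) : ℝ)‖ ^ 2 :=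
    (summable_prod_of_nonneg fun _ => by positivity).2 ⟨fun j => (hP j).summable, .of_finite⟩
  have htsum := hsumJ.tsum_prod' fun j => (hP j).summable
  simp only [(hP _).tsum_eq, tsum_fintype] at htsum
  have hsq : Integrable fun ξ => ‖G ξ‖ ^ 2 := hG.norm.integrable_sq
  -- the pointwise inequality for the folded functions, integrated over `[0, 1 / m]`
  have hfold : c * ∫ ξ, ‖G ξ‖ ^ 2 ≤ ∑ j : J, ∫ s in (0 : ℝ)..1 / m, ‖fold m (j : Fin m) G s‖ ^ 2 := by
    have h1 : ∫ ξ, ‖G ξ‖ ^ 2 = ∫ s in (0 : ℝ)..1 / m, ∑ l : Fin m, ‖G (s + (l : ℕ) / m)‖ ^ 2 := by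
      rw [intervalIntegral.integral_finsetSum
        fun l _ => (hsq.comp_add_right _).intervalIntegrable, ← sum_intervalIntegral_fin hm hsq,
        intervalIntegral.integral_of_le zero_le_one, ← integral_Icc_eq_integral_Ioc,
        setIntegral_eq_integral_of_ae_compl_eq_zero]
      filter_upwards [h0] with ξ hξ hn
      rw [hξ hn]; simp
    have hint : ∀ j : ℕ, IntervalIntegrable (fun s => ‖fold m j G s‖ ^ 2) volume 0 (1 / m) :=
      fun j => (memLp_fold m j hG).norm.integrable_sq.intervalIntegrable
    rw [h1, ← intervalIntegral.integral_const_mul,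
      ← intervalIntegral.integral_finsetSum fun j _ => hint _]
    have hzero : ∀ᵐ s : ℝ, ∀ l : Fin m, 2 * Real.pi * (s + (l : ℕ) / m) ∉ S →
        G (s + (l : ℕ) / m) = 0 := by
      rw [ae_all_iff]
      exact fun l => (measurePreserving_add_right volume _).quasiMeasurePreserving.ae hz
    rw [intervalIntegral.integral_of_le hpos.le, intervalIntegral.integral_of_le hpos.le]
    refine integral_mono_ae ?_ ?_ ?_
    · exact ((integrable_finsetSum _ fun l _ => hsq.comp_add_right _).const_mul c).integrableOn
    · exact (integrable_finsetSum _ fun j _ =>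
        (memLp_fold m _ hG).norm.integrable_sq).integrableOn
    · filter_upwards [ae_restrict_of_ae hzero, ae_restrict_mem measurableSet_Ioc] with s hs hsI
      have := hJ (fun l => G (s + (l : ℕ) / m)) fun l hl => hs l fun hmem => hl (hI l s hsI hmem)
      refine this.trans_eq ?_
      rw [← Finset.sum_coe_sort J]
      rfl
  refine ⟨𝓕⁻ G, hcont, hinv hGi, ?_, ?_⟩
  · rw [← (periodicSetEquiv hm J).summable_iff]
    exact hsumJ
  · rw [← (periodicSetEquiv hm J).tsum_eq]
    refine le_trans ?_ htsum.ge
    rw [hFG, ← Finset.mul_sum, div_mul_eq_mul_div, inv_mul_eq_div]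
    exact div_le_div_of_nonneg_right hfold hmR.le

end PaleyWiener

namespace PaleyWiener

/-! ### Columns of the Fourier matrix that cover the spectrum -/

theorem SamplingBound.mono {S : Set ℝ} {Λ : Set ℤ} {B B' : ℝ} (h : SamplingBound S Λ B)
    (hB : B' ≤ B) : SamplingBound S Λ B' := by
  intro F hF
  obtain ⟨f, h1, h2, h3, h4⟩ := h F hF
  exact ⟨f, h1, h2, h3, (mul_le_mul_of_nonneg_right hB (by positivity)).trans h4⟩

/-- Outer approximation of a compact spectrum by intervals of length `1 / m`, with as many of them
as desired. -/
theorem exists_cover {S : Set ℝ} (hS : IsCompact S) (hS2 : S ⊆ Set.Icc 0 (2 * Real.pi))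
    (hpos : 0 < nmeas S) {ε : ℝ} (hε : 0 < ε) (K : ℝ) :
    ∃ (m : ℕ) (I : Finset (Fin m)), 0 < m ∧
      (∀ l : Fin m, ∀ s ∈ Set.Ioc (0 : ℝ) (1 / m), 2 * Real.pi * (s + (l : ℕ) / m) ∈ S → l ∈ I) ∧
      nmeas S ≤ I.card / m ∧ (I.card : ℝ) / m < (1 + ε) * nmeas S ∧ K ≤ I.card := by
  classical
  have hpi : (0 : ℝ) < 2 * Real.pi := by positivity
  set S' : Set ℝ := (fun ξ => 2 * Real.pi * ξ) ⁻¹' S with hS'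
  have hS'c : IsCompact S' := by
    refine ((Homeomorph.mulLeft₀ (2 * Real.pi) hpi.ne').isClosedEmbedding).isCompact_preimage hS
  have hvol : volume.real S' = nmeas S := by
    rw [measureReal_def, hS', Real.volume_preimage_mul_left hpi.ne', ENNReal.toReal_mul,
      ENNReal.toReal_ofReal (abs_nonneg _), abs_of_pos (inv_pos.2 hpi), nmeas, measureReal_def,
      inv_mul_eq_div]
  have hlim := tendsto_measure_cthickening_of_isCompact (μ := (volume : Measure ℝ)) hS'c
  have hlt : volume S' < ENNReal.ofReal ((1 + ε) * nmeas S) := by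
    rw [ENNReal.lt_ofReal_iff_toReal_lt hS'c.measure_ne_top, ← measureReal_def, hvol]
    nlinarith
  have h1m : Tendsto (fun m : ℕ => 1 / (m : ℝ)) atTop (𝓝 0) := tendsto_one_div_atTop_nhds_zero_nat
  have hev := (hlim.comp h1m).eventually (eventually_lt_nhds hlt)
  have hevK : ∀ᶠ m : ℕ in atTop, K / nmeas S ≤ m := 
    tendsto_natCast_atTop_atTop.eventually_ge_atTop _
  obtain ⟨m, hm1, hmK, hm⟩ := (hev.and (hevK.and (eventually_gt_atTop 0))).exists
  have hmR : (0 : ℝ) < m := by exact_mod_cast hm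
  set I : Finset (Fin m) := Finset.univ.filter fun l =>
    ∃ s ∈ Set.Icc (0 : ℝ) (1 / m), s + (l : ℕ) / m ∈ S' with hI
  have hcov : S' ⊆ ⋃ l ∈ I, Set.Icc (((l : ℕ) : ℝ) / m) (1 / m + (l : ℕ) / m) := by
    intro ξ hξ
    have hξ2 := hS2 hξ
    have h01 : 0 ≤ ξ ∧ ξ ≤ 1 := ⟨by nlinarith [hξ2.1], by nlinarith [hξ2.2]⟩
    obtain ⟨l, hl⟩ : ∃ l : Fin m, ξ ∈ Set.Icc (((l : ℕ) : ℝ) / m) (1 / m + (l : ℕ) / m) := by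
      rcases h01.2.lt_or_eq with h | h
      · have hfl := Nat.floor_le (mul_nonneg h01.1 hmR.le)
        have hfl2 := Nat.lt_floor_add_one (ξ * m)
        refine ⟨⟨⌊ξ * m⌋₊, ?_⟩, ?_, ?_⟩
        · rw [Nat.floor_lt (mul_nonneg h01.1 hmR.le)]; nlinarith
        · rwa [div_le_iff₀ hmR]
        · rw [← add_div, le_div_iff₀ hmR]
          simp only
          linarith
      · refine ⟨⟨m - 1, by omega⟩, ?_, ?_⟩
        · rw [h, div_le_one hmR]; exact_mod_cast Nat.sub_le m 1
        · rw [h, ← add_div, le_div_iff₀ hmR, one_mul]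
          simp only [Nat.cast_sub (Nat.one_le_of_lt hm)]
          push_cast
          linarith
    simp only [Set.mem_iUnion]
    refine ⟨l, ?_, hl⟩
    rw [hI, Finset.mem_filter]
    exact ⟨Finset.mem_univ _, ξ - (l : ℕ) / m, ⟨by linarith [hl.1], by linarith [hl.2]⟩,
      by simpa using hξ⟩
  have hlow : nmeas S ≤ I.card / m := by
    rw [← hvol]
    refine (measureReal_mono hcov ?_).trans ((measureReal_biUnion_finset_le _ _).trans ?_)
    · exact (I.isCompact_biUnion fun _ _ => isCompact_Icc).measure_ne_top
    · simp only [Real.volume_real_Icc, add_sub_cancel_right]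
      rw [max_eq_left (by positivity), Finset.sum_const, nsmul_eq_mul, mul_one_div]
  refine ⟨m, I, hm, ?_, hlow, ?_, ?_⟩
  · intro l s hs hl
    rw [hI, Finset.mem_filter]
    exact ⟨Finset.mem_univ _, s, ⟨hs.1.le, hs.2⟩, hl⟩
  · have hsub : (⋃ l ∈ I, Set.Ioo (((l : ℕ) : ℝ) / m) (1 / m + (l : ℕ) / m)) ⊆
        Metric.cthickening (1 / m) S' := by
      simp only [Set.iUnion_subset_iff]
      intro l hl x hx
      rw [hI, Finset.mem_filter] at hl
      obtain ⟨-, s, hs, hsS⟩ := hl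
      refine Metric.mem_cthickening_of_dist_le _ _ _ _ hsS ?_
      rw [Real.dist_eq, abs_le]
      constructor <;> linarith [hx.1, hx.2, hs.1, hs.2]
    have hdisj : Set.PairwiseDisjoint (I : Set (Fin m))
        fun l => Set.Ioo (((l : ℕ) : ℝ) / m) (1 / m + (l : ℕ) / m) := by
      have key : ∀ l l' : Fin m, l < l' → Disjoint (Set.Ioo (((l : ℕ) : ℝ) / m) (1 / m + (l : ℕ) / m))
          (Set.Ioo (((l' : ℕ) : ℝ) / m) (1 / m + (l' : ℕ) / m)) := by
        intro l l' hll
        rw [Set.disjoint_left]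
        intro x hx hx'
        have h1 : ((l : ℕ) : ℝ) + 1 ≤ (l' : ℕ) := by exact_mod_cast hll
        have h2 : (1 : ℝ) / m + (l : ℕ) / m ≤ (l' : ℕ) / m := by
          rw [← add_div]; gcongr; linarith
        linarith [hx.2, hx'.1]
      intro l _ l' _ hne
      rcases lt_or_gt_of_ne hne with h | h
      · exact key l l' h
      · exact (key l' l h).symm
    have hmeas : volume (⋃ l ∈ I, Set.Ioo (((l : ℕ) : ℝ) / m) (1 / m + (l : ℕ) / m)) =
        ENNReal.ofReal (I.card / m) := by
      rw [measure_biUnion_finset hdisj fun _ _ => measurableSet_Ioo]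
      simp only [Real.volume_Ioo, add_sub_cancel_right]
      rw [Finset.sum_const, ← ENNReal.ofReal_nsmul, nsmul_eq_mul, mul_one_div]
    have := (measure_mono hsub).trans_lt hm1
    rw [hmeas] at this
    exact (ENNReal.ofReal_lt_ofReal_iff (by positivity)).1 this
  · rw [div_le_iff₀ hpos] at hmK
    rw [le_div_iff₀ hmR] at hlow
    linarith

theorem sum_exp_div_eq_zero {m : ℕ} {a b : Fin m} (hab : a ≠ b) :
    ∑ j : Fin m,
      Complex.exp (2 * Real.pi * Complex.I * (j : ℕ) * (((b : ℕ) : ℂ) - (a : ℕ)) / m) = 0 := by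
  have hm : m ≠ 0 := fun h => by subst h; exact a.elim0
  have hmC : (m : ℂ) ≠ 0 := by exact_mod_cast hm
  set z := Complex.exp (2 * Real.pi * Complex.I * (((b : ℕ) : ℂ) - (a : ℕ)) / m) with hz
  have hzj : ∀ j : ℕ, Complex.exp (2 * Real.pi * Complex.I * j * (((b : ℕ) : ℂ) - (a : ℕ)) / m) =
      z ^ j := fun j => by
    rw [hz, ← Complex.exp_nat_mul]; congr 1; ring
  have hz1 : z ≠ 1 := by
    intro h
    obtain ⟨k, hk⟩ := Complex.exp_eq_one_iff.1 h
    have hpi : (2 * Real.pi * Complex.I : ℂ) ≠ 0 := Complex.two_pi_I_ne_zero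
    have h1 : (((b : ℕ) : ℂ) - (a : ℕ)) = k * m := by
      field_simp at hk
      rw [hk]; ring
    have h2 : ((b : ℕ) : ℤ) - (a : ℕ) = k * m := by exact_mod_cast h1
    have h3 := a.2
    have h4 := b.2
    have h5 : k = 0 := by
      by_contra hk0
      rcases lt_or_gt_of_ne hk0 with h | h
      · nlinarith
      · nlinarith
    rw [h5, zero_mul] at h2
    exact hab (Fin.ext (by omega))
  have hzm : z ^ m = 1 := by
    rw [hz, ← Complex.exp_nat_mul, mul_div_cancel₀ _ hmC]
    have := Complex.exp_int_mul_two_pi_mul_I (((b : ℕ) : ℤ) - (a : ℕ))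
    rw [← this]
    congr 1; push_cast; ring
  simp only [hzj]
  rw [Fin.sum_univ_eq_sum_range fun j => z ^ j, geom_sum_eq hz1, hzm, sub_self, zero_div]

open Matrix in
/-- `exists_subframe` for the rows of a column submatrix of the Fourier matrix; these form a tight
frame because the columns are orthogonal. -/
theorem exists_rows {d : ℝ} (hd : 0 < d) : ∃ c : ℝ, 0 < c ∧
    ∀ (m : ℕ) (I : Finset (Fin m)), 0 < m → 2 ≤ d * I.card →
      ∃ J : Finset (Fin m), (J.card : ℝ) ≤ (1 + d) * I.card ∧
        ∀ g : Fin m → ℂ, (∀ l ∉ I, g l = 0) → c * I.card * ∑ l, ‖g l‖ ^ 2 ≤ ∑ j ∈ J, ‖∑ l : Fin m,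
          Complex.exp (2 * Real.pi * Complex.I * (j : ℕ) * (l : ℕ) / m) * g l‖ ^ 2 := by
  obtain ⟨c, hc, h⟩ := exists_subframe hd
  refine ⟨c, hc, fun m I hm hdI => ?_⟩
  have : NeZero m := ⟨hm.ne'⟩
  have hn : (0 : ℝ) < I.card := pos_of_mul_pos_right (by linarith : 0 < d * (I.card : ℝ)) hd.le
  set q : ℝ := (Real.sqrt I.card)⁻¹ with hq
  have hq2 : q ^ 2 = (I.card : ℝ)⁻¹ := by rw [hq, inv_pow, Real.sq_sqrt hn.le]
  -- the conjugates of the rows, normalized to length one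
  set u : Fin m → I → ℂ := fun j a =>
    q * Complex.exp (-(2 * Real.pi * Complex.I * (j : ℕ) * ((a : Fin m) : ℕ) / m)) with hu
  have hstar : ∀ j a, star (u j a) =
      q * Complex.exp (2 * Real.pi * Complex.I * (j : ℕ) * ((a : Fin m) : ℕ) / m) := by
    intro j a
    simp only [hu, Complex.star_def, map_mul, Complex.conj_ofReal, ← Complex.exp_conj]
    congr 2
    simp [map_ofNat]
    ring
  have hmul : ∀ j a b, u j a * star (u j b) = ((I.card : ℝ)⁻¹ : ℝ) *
      Complex.exp (2 * Real.pi * Complex.I * (j : ℕ) * (((b : Fin m) : ℕ) - ((a : Fin m) : ℕ)) / m) := by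
    intro j a b
    rw [hstar, ← hq2, hu]
    simp only
    rw [mul_mul_mul_comm, ← Complex.exp_add]
    push_cast
    rw [pow_two]
    congr 2
    ring
  have hκ : (1 : ℝ) ≤ m / I.card := by
    rw [one_le_div hn]
    exact_mod_cast (Finset.card_le_univ I).trans_eq (Fintype.card_fin m)
  have hcard : (m / I.card : ℝ) * Fintype.card I = Fintype.card (Fin m) := by
    rw [Fintype.card_coe, Fintype.card_fin, div_mul_cancel₀ _ hn.ne']
  have htight : frameMatrix u (fun _ => 1) = ((m / I.card : ℝ) : ℂ) • 1 := by
    ext a b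
    simp only [frameMatrix, one_smul, Matrix.sum_apply, vecMulVec_apply, Pi.star_apply, hmul]
    rw [← Finset.mul_sum, Matrix.smul_apply, Matrix.one_apply]
    by_cases hab : a = b
    · subst hab
      simp
      ring
    · rw [sum_exp_div_eq_zero fun h => hab (Subtype.ext h)]
      simp [hab]
  have hunit : ∀ j, star (u j) ⬝ᵥ u j = 1 := by
    intro j
    have : star (u j) ⬝ᵥ u j = ∑ a : I, (((I.card : ℝ)⁻¹ : ℝ) : ℂ) := by
      simp only [dotProduct, Pi.star_apply]
      refine Finset.sum_congr rfl fun a _ => ?_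
      rw [mul_comm, hmul, sub_self]; simp
    rw [this, Finset.sum_const, Finset.card_univ, Fintype.card_coe, nsmul_eq_mul]
    have : (I.card : ℂ) ≠ 0 := by exact_mod_cast hn.ne'
    push_cast
    exact mul_inv_cancel₀ this
  have hdI' : 2 ≤ d * Fintype.card I := by
    rwa [Fintype.card_coe]
  obtain ⟨J, hJc, hJ⟩ := h (Fin m) I u (m / I.card) hκ hcard htight hunit hdI'
  rw [Fintype.card_coe] at hJc
  refine ⟨J, hJc, fun g hg => ?_⟩
  have := hJ fun a => g a
  have e1 : ∑ a : I, ‖g a‖ ^ 2 = ∑ l, ‖g l‖ ^ 2 := by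
    rw [Finset.sum_coe_sort I (fun l => ‖g l‖ ^ 2)]
    refine Finset.sum_subset (Finset.subset_univ _) fun l _ hl => ?_
    rw [hg l hl]; simp
  have e2 : ∀ j, ‖star (u j) ⬝ᵥ fun a : I => g a‖ ^ 2 = (I.card : ℝ)⁻¹ * ‖∑ l : Fin m,
        Complex.exp (2 * Real.pi * Complex.I * (j : ℕ) * (l : ℕ) / m) * g l‖ ^ 2 := by
    intro j
    have : (star (u j) ⬝ᵥ fun a : I => g a) = q * ∑ l : Fin m,
        Complex.exp (2 * Real.pi * Complex.I * (j : ℕ) * (l : ℕ) / m) * g l := by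
      simp only [dotProduct, Pi.star_apply, hstar]
      simp only [mul_assoc (q : ℂ)]
      rw [← Finset.mul_sum, Finset.sum_coe_sort I (fun l : Fin m =>
        Complex.exp (2 * Real.pi * Complex.I * (j : ℕ) * (l : ℕ) / m) * g l)]
      congr 1
      refine Finset.sum_subset (Finset.subset_univ _) fun l _ hl => ?_
      rw [hg l hl, mul_zero]
    rw [this, norm_mul, mul_pow, Complex.norm_real, Real.norm_eq_abs, sq_abs, hq2]
  simp only [e1, e2] at this
  rw [← Finset.mul_sum, inv_mul_eq_div, le_div_iff₀ hn] at this
  linarith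

end PaleyWiener

theorem theorem1 (d : ℝ) (hd : 0 < d) :
    ∃ C : ℝ, 0 < C ∧
      ∀ S : Set ℝ, IsCompact S → S ⊆ Set.Icc 0 (2 * Real.pi) → 0 < volume S →
        ∃ (Λ : Set ℤ) (D : ℝ),
          PaleyWiener.IsFiniteUnionAP Λ ∧
          PaleyWiener.HasUniformDensity Λ D ∧
          D < (1 + d) * PaleyWiener.nmeas S ∧
          PaleyWiener.SamplingBound S Λ (C * PaleyWiener.nmeas S) := by
  -- `d` is split between the selection of rows and the covering of `S`: `(1 + ε)² ≤ 1 + d`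
  set ε : ℝ := min 1 (d / 3) with hε
  have hε0 : 0 < ε := by positivity
  have hε1 : ε ≤ 1 := min_le_left _ _
  have hεd : ε ≤ d / 3 := min_le_right _ _
  obtain ⟨c, hc, hrows⟩ := PaleyWiener.exists_rows hε0
  refine ⟨c, hc, fun S hS hS2 hpos => ?_⟩
  have hn : 0 < PaleyWiener.nmeas S :=
    div_pos (ENNReal.toReal_pos hpos.ne' hS.measure_ne_top) (by positivity)
  obtain ⟨m, I, hm, hI, hlow, hup, hK⟩ := PaleyWiener.exists_cover hS hS2 hn hε0 (2 / ε)
  have hmR : (0 : ℝ) < m := by exact_mod_cast hm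
  rw [div_le_iff₀' hε0] at hK
  obtain ⟨J, hJc, hJ⟩ := hrows m I hm hK
  refine ⟨PaleyWiener.periodicSet J, J.card / m, PaleyWiener.isFiniteUnionAP_periodicSet hm J,
    PaleyWiener.hasUniformDensity_periodicSet hm J, ?_,
    (PaleyWiener.samplingBound_periodicSet hm J I hJ hS2 hI).mono ?_⟩
  · calc (J.card : ℝ) / m ≤ (1 + ε) * I.card / m := by gcongr
      _ = (1 + ε) * (I.card / m) := by ring
      _ < (1 + ε) * ((1 + ε) * PaleyWiener.nmeas S) := by gcongr
      _ = (1 + ε) ^ 2 * PaleyWiener.nmeas S := by ring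
      _ ≤ (1 + d) * PaleyWiener.nmeas S := by
        refine mul_le_mul_of_nonneg_right ?_ hn.le
        nlinarith
  · rw [mul_div_assoc]
    gcongr
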